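/- **Setting.** An instance $I=(G,k,\phi,\tau)$ of Node Unique Label Cover over a finite alphabet $\Sigma$ consists of a finite simple graph $G$, an integer $k\ge 0$, for every edge $e=uw$ and each endpoint $u$ of $e$ a permutation $\phi_{e,u}$ of $\Sigma$ with $\phi_{e,u}=\phi_{e,w}^{-1}$, and a function $\tau:V(G)\to 2^{\Sigma}$. For $X\subseteq V(G)$, a labeling $\Psi:V(G)\setminus X\to\Sigma$ is *feasible for $G-X$* if $\Psi(w)=\phi_{e,u}(\Psi(u))$ for every edge $e=uw$ of $G-X$, and *consistent with $\tau$* if $\Psi(u)\in\tau(u)$ for all $u\notin X$. A *solution* of $I$ is a set $X\subseteq V(G)$ with $|X|\le k$ such that $G-X$ has a feasible labeling consistent with $\tau$. The auxiliary graph $H_I$ has vertex set $V(G)\times\Sigma$, with $(u,i)$ written $u_i$ (a *copy* of $u$), and $u_i$ is adjacent to $w_j$ iff $e=uw\in E(G)$ and $j=\phi_{e,u}(i)$. For $X\subseteq V(G)$, $[X]$ is the set of all copies of vertices of $X$. A set of vertices of $H_I$ is *regular* if it contains at most one copy of each vertex of $G$. For a vertex $a$ of $H_I$ and a set $T$ of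 vertices of $H_I$, an *$a$–$T$ separator* is a set $S$ of vertices of $H_I$ with $a\notin S$ such that $H_I-S$ contains no path from $a$ to a vertex of $T$ (in particular, $a\notin T$; $S$ may contain vertices of $T$). $R(a,S)$ denotes the vertex set of the component of $H_I-S$ containing $a$. A separator $S$ is *minimum* if it has the smallest size among all $a$–$T$ separators, and it is *good* if $R(a,S)\cup S$ is regular. **Lemma (Persistence Lemma).** Let $X$ be a solution of $I$ and let $\Psi$ be a feasible labeling of $G-X$ consistent with $\tau$. Let $v\in V(G)\setminus X$ and $\alpha\in\Sigma$ with $\tau(v)=\{\alpha\}$, and let $T=\{u_\gamma : u\in V(G),\ \gamma\in\Sigma\setminus\tau(u)\}$. Then: 1. $[X]$ is a $v_\alpha$–$T$ separator in $H_I$. 2. If $S$ is a good minimum $v_\alpha$–$T$ separator in $H_I$, then there is a solution $X'$ of $I$ with $|X'|\le|X|$ that contains no vertex of $G$ having a copy in $R(v_\alpha,S)$. In particular, if $X$ is a solution of minimum size, then so is $X'$. Statement 2 also holds if separators are required in addition to be disjoint from $T$, that is, for every $S$ with $R(v_\alpha,S)\cup S$ regular that has minimum size among the $v_\alpha$–$T$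 separators disjoint from $T$. -/

import Mathlib

/-- An instance `(G, k, φ, τ)` of Node Unique Label Cover on the vertex set `V` over the
alphabet `L`. For an edge `e = uw`, `perm h` with `h : G.Adj u w` is the permutation `φ_{e,u}`. -/
structure NULCInstance (V L : Type*) where
  G : SimpleGraph V
  k : ℕ
  perm : ∀ {u w : V}, G.Adj u w → Equiv.Perm L
  perm_symm : ∀ {u w : V} (h : G.Adj u w), perm h = (perm h.symm)⁻¹
  τ : V → Set L

/-- `R(A, S)`: the vertices of the components of `H - S` that intersect `A`. -/
def reachSet {W : Type*} (H : SimpleGraph W) (A S : Set W) : Set W :=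
  {b | ∃ a ∈ A, ∃ p : H.Walk a b, ∀ x ∈ p.support, x ∉ S}

/-- `S` is disjoint from `A`, and `H - S` has no path from `A` to `B`.
The set `S` is allowed to contain vertices of `B`. -/
def IsSeparator {W : Type*} (H : SimpleGraph W) (A B S : Set W) : Prop :=
  Disjoint S A ∧ ∀ a ∈ A, ∀ b ∈ B, ∀ p : H.Walk a b, ∃ x ∈ p.support, x ∈ S

/-- A separator that is moreover disjoint from the target set `B`. -/
def IsStrictSeparator {W : Type*} (H : SimpleGraph W) (A B S : Set W) : Prop :=
  IsSeparator H A B S ∧ Disjoint S B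

/-- `S` has minimum cardinality among the sets with property `P`. -/
def IsMinimumSet {W : Type*} (P : Set W → Prop) (S : Set W) : Prop :=
  P S ∧ ∀ S', P S' → S.ncard ≤ S'.ncard

namespace NULCInstance

variable {V L : Type*}

/-- `Ψ` is a feasible labeling of `G - X`. -/
def IsFeasible (I : NULCInstance V L) (X : Set V) (Ψ : {u : V // u ∉ X} → L) : Prop :=
  ∀ (u w : {u : V // u ∉ X}) (h : I.G.Adj u.1 w.1), I.perm h (Ψ u) = Ψ w

/-- The labeling `Ψ` of `G - X` is consistent with `τ`. -/
def IsConsistent (I : NULCInstance V L) (X : Set V) (Ψ : {u : V // u ∉ X} → L) : Prop :=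
  ∀ u : {u : V // u ∉ X}, Ψ u ∈ I.τ u.1

/-- `X` is a deletion set witnessing that the instance is a yes-instance: `|X| ≤ k`, and `G - X`
has a feasible labeling consistent with `τ`. -/
def IsSolution (I : NULCInstance V L) (X : Set V) : Prop :=
  X.ncard ≤ I.k ∧ ∃ Ψ : {u : V // u ∉ X} → L, I.IsFeasible X Ψ ∧ I.IsConsistent X Ψ

/-- The auxiliary graph `H_I` on `V × L`; the pair `(u, i)` is the copy `u_i`. -/
def auxGraph (I : NULCInstance V L) : SimpleGraph (V × L) where
  Adj a b := ∃ h : I.G.Adj a.1 b.1, I.perm h a.2 = b.2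
  symm := ⟨by
    rintro a b ⟨h, hab⟩
    refine ⟨h.symm, ?_⟩
    rw [I.perm_symm h.symm, ← hab]
    simp⟩
  loopless := ⟨fun a h => I.G.loopless.irrefl a.1 h.1⟩

/-- `[X]`: all copies of the vertices of `X`. -/
def copies (X : Set V) : Set (V × L) := {a | a.1 ∈ X}

/-- `Z⁻¹`: the vertices of `G` that have a copy in `Z`. -/
def proj (Z : Set (V × L)) : Set V := {u | (copies {u} ∩ Z).Nonempty}

/-- A set of vertices of `H_I` is regular if it has at most one copy of each vertex of `G`. -/
def IsRegular (Z : Set (V × L)) : Prop := ∀ u : V, (Z ∩ copies {u}).encard ≤ 1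

/-- `T`: the copies `u_γ` with `γ ∉ τ(u)`. -/
def forbidden (I : NULCInstance V L) : Set (V × L) := {a | a.2 ∉ I.τ a.1}

/-- `R[A, S] = R(A, S) ∪ S` is regular. -/
def IsGood (I : NULCInstance V L) (A S : Set (V × L)) : Prop :=
  IsRegular (reachSet I.auxGraph A S ∪ S)

end NULCInstance

/-! Write `R` for `R(v_α, S)` and `C` for the part of `S` that conflicts with `Ψ`. The new solution
is `X' = (X \ proj R) ∪ proj C`: vertices with a copy in `R` take the label of that copy, unique by
regularity, and all others keep `Ψ`. An edge leaving `R` ends in `S`, where the label is either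
deleted with `C` or agrees with `Ψ` (`exists_labeling_of_isGood`). For the size, `(S \ C) ∪ ([X] ∩
R)` is again a separator (`isSeparator_exchange`), so minimality gives `|C| ≤ |[X] ∩ R|`, which is
at most `|X ∩ proj R|` by regularity. -/

theorem reachSet_disjoint_separator {W : Type*} {H : SimpleGraph W} {A S : Set W} :
    Disjoint (reachSet H A S) S := by
  rw [Set.disjoint_left]
  rintro b ⟨a, -, p, hp⟩
  exact hp b p.end_mem_support

theorem IsSeparator.reachSet_disjoint {W : Type*} {H : SimpleGraph W} {A B S : Set W}
    (hS : IsSeparator H A B S) : Disjoint (reachSet H A S) B := by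
  rw [Set.disjoint_left]
  rintro b ⟨a, ha, p, hp⟩ hb
  obtain ⟨x, hx, hxS⟩ := hS.2 a ha b hb p
  exact hp x hx hxS

/-- A neighbour of `R(A, S)` lies in `R(A, S) ∪ S`. -/
theorem mem_reachSet_union_of_adj {W : Type*} {H : SimpleGraph W} {A S : Set W} {b c : W}
    (hb : b ∈ reachSet H A S) (h : H.Adj b c) : c ∈ reachSet H A S ∪ S := by
  by_cases hc : c ∈ S
  · exact Or.inr hc
  · obtain ⟨a, ha, p, hp⟩ := hb
    refine Or.inl ⟨a, ha, p.concat h, fun x hx => ?_⟩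
    rw [SimpleGraph.Walk.support_concat] at hx
    simp only [List.mem_append, List.mem_singleton] at hx
    rcases hx with hx | rfl
    · exact hp x hx
    · exact hc

/-- If every edge leaving `Q \ S` ends in `Q ∪ S`, and `A ⊆ Q` while `Q \ S` misses `B`, then `S`
separates `A` from `B`. -/
theorem isSeparator_of_closed {W : Type*} {H : SimpleGraph W} {A B S Q : Set W}
    (hSA : Disjoint S A) (hAQ : A ⊆ Q) (hQB : Disjoint (Q \ S) B)
    (hQ : ∀ b ∈ Q, b ∉ S → ∀ c, H.Adj b c → c ∉ S → c ∈ Q) : IsSeparator H A B S := by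
  refine ⟨hSA, fun a ha b hb p => ?_⟩
  by_contra! hp
  have key : ∀ {a b : W} (p : H.Walk a b), (∀ x ∈ p.support, x ∉ S) → a ∈ Q → b ∈ Q := by
    intro a b p
    induction p with
    | nil => exact fun _ h => h
    | cons h p ih =>
      intro hp ha
      refine ih (fun x hx => hp x (by simp [hx])) (hQ _ ha (hp _ (by simp)) _ h ?_)
      exact hp _ (by simp)
  exact Set.disjoint_left.1 hQB ⟨key p hp (hAQ ha), hp b p.end_mem_support⟩ hb

namespace NULCInstance

variable {V L : Type*}

theorem mem_proj {Z : Set (V × L)} {u : V} : u ∈ proj Z ↔ ∃ i, (u, i) ∈ Z := by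
  constructor
  · rintro ⟨⟨w, i⟩, hw, hZ⟩
    obtain rfl : w = u := hw
    exact ⟨i, hZ⟩
  · rintro ⟨i, hi⟩
    exact ⟨(u, i), rfl, hi⟩

theorem proj_eq_image (Z : Set (V × L)) : proj Z = Prod.fst '' Z := by
  ext u
  simp [mem_proj]

theorem IsRegular.eq {Z : Set (V × L)} (hZ : IsRegular Z) {u : V} {i j : L}
    (hi : (u, i) ∈ Z) (hj : (u, j) ∈ Z) : i = j := by
  have := Set.encard_le_one_iff.1 (hZ u) (u, i) (u, j) ⟨hi, rfl⟩ ⟨hj, rfl⟩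
  exact congrArg Prod.snd this

/-- The copies that agree with the labeling `Ψ` of `G - X`. -/
def graphOf (X : Set V) (Ψ : {u : V // u ∉ X} → L) : Set (V × L) :=
  {a | ∃ h : a.1 ∉ X, Ψ ⟨a.1, h⟩ = a.2}

theorem IsFeasible.mem_graphOf_of_adj {I : NULCInstance V L} {X : Set V}
    {Ψ : {u : V // u ∉ X} → L} (hfeas : I.IsFeasible X Ψ) {b c : V × L}
    (hb : b ∈ graphOf X Ψ) (h : I.auxGraph.Adj b c) (hc : c.1 ∉ X) : c ∈ graphOf X Ψ := by
  obtain ⟨hbX, hb⟩ := hb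
  obtain ⟨hadj, hbc⟩ := h
  refine ⟨hc, ?_⟩
  rw [← hbc, ← hb]
  exact (hfeas ⟨b.1, hbX⟩ ⟨c.1, hc⟩ hadj).symm

theorem IsConsistent.graphOf_disjoint_forbidden {I : NULCInstance V L} {X : Set V}
    {Ψ : {u : V // u ∉ X} → L} (hcons : I.IsConsistent X Ψ) :
    Disjoint (graphOf X Ψ) I.forbidden := by
  rw [Set.disjoint_left]
  rintro a ⟨ha, h⟩ hf
  exact hf (h ▸ hcons ⟨a.1, ha⟩)

/-- Feasibility keeps a walk avoiding `[X]` on the graph of `Ψ`, which misses `T` by consistency. -/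
theorem isSeparator_copies {I : NULCInstance V L} {X : Set V} {Ψ : {u : V // u ∉ X} → L}
    (hfeas : I.IsFeasible X Ψ) (hcons : I.IsConsistent X Ψ) {a : V × L}
    (ha : a ∈ graphOf X Ψ) : IsSeparator I.auxGraph {a} I.forbidden (copies X) := by
  refine isSeparator_of_closed (Q := graphOf X Ψ) ?_ (by simpa using ha) ?_ ?_
  · rw [Set.disjoint_singleton_right]
    exact ha.1
  · exact hcons.graphOf_disjoint_forbidden.mono_left Set.sdiff_subset
  · exact fun b hb _ c h hc => hfeas.mem_graphOf_of_adj hb h hc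

/-- The vertices of `S` that survive the deletion of `X` with a label other than the one
prescribed by `S`. -/
def conflictSet (X : Set V) (Ψ : {u : V // u ∉ X} → L) (S : Set (V × L)) : Set (V × L) :=
  {a ∈ S | a.1 ∉ X ∧ a ∉ graphOf X Ψ}

/-- Exchanging the conflicting part of a separator for the copies of `X` behind it yields a
separator again. -/
theorem isSeparator_exchange {I : NULCInstance V L} {X : Set V} {Ψ : {u : V // u ∉ X} → L}
    (hfeas : I.IsFeasible X Ψ) {a : V × L} (ha : a ∈ graphOf X Ψ) {S : Set (V × L)}
    (hS : IsSeparator I.auxGraph {a} I.forbidden S) :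
    IsSeparator I.auxGraph {a} I.forbidden
      ((S \ conflictSet X Ψ S) ∪ (copies X ∩ reachSet I.auxGraph {a} S)) := by
  have haS : a ∉ S := Set.disjoint_singleton_right.1 hS.1
  refine isSeparator_of_closed (Q := graphOf X Ψ ∩ reachSet I.auxGraph {a} S) ?_ ?_ ?_ ?_
  · rw [Set.disjoint_singleton_right]
    rintro (h | h)
    · exact haS h.1
    · exact ha.1 h.1
  · rw [Set.singleton_subset_iff]
    exact ⟨ha, a, rfl, .nil, by simpa using haS⟩
  · exact hS.reachSet_disjoint.mono_left (Set.sdiff_subset.trans Set.inter_subset_right)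
  · rintro b ⟨hbΨ, hbR⟩ - c h hc
    rcases mem_reachSet_union_of_adj hbR h with hcR | hcS
    · have hcX : c.1 ∉ X := fun hX => hc (Or.inr ⟨hX, hcR⟩)
      exact ⟨hfeas.mem_graphOf_of_adj hbΨ h hcX, hcR⟩
    -- A walk can enter `S` unblocked only at a conflict, but feasibility makes `c` agree with `Ψ`.
    · have hcC : c ∈ conflictSet X Ψ S := by
        by_contra hcC
        exact hc (Or.inl ⟨hcS, hcC⟩)
      exact absurd (hfeas.mem_graphOf_of_adj hbΨ h hcC.2.1) hcC.2.2

theorem ncard_conflictSet_le [Finite V] [Finite L] {I : NULCInstance V L} {X : Set V}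
    {Ψ : {u : V // u ∉ X} → L} (hfeas : I.IsFeasible X Ψ) {a : V × L} (ha : a ∈ graphOf X Ψ)
    {S : Set (V × L)}
    (hS : IsMinimumSet (IsSeparator I.auxGraph {a} I.forbidden) S ∨
      IsMinimumSet (IsStrictSeparator I.auxGraph {a} I.forbidden) S) :
    (conflictSet X Ψ S).ncard ≤ (copies X ∩ reachSet I.auxGraph {a} S).ncard := by
  have hle : S.ncard ≤
      ((S \ conflictSet X Ψ S) ∪ (copies X ∩ reachSet I.auxGraph {a} S)).ncard := by
    rcases hS with ⟨hS, hmin⟩ | ⟨⟨hS, hST⟩, hmin⟩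
    · exact hmin _ (isSeparator_exchange hfeas ha hS)
    -- The exchange stays disjoint from `T` because `R` misses `T`.
    · refine hmin _ ⟨isSeparator_exchange hfeas ha hS, ?_⟩
      exact Set.disjoint_union_left.2 ⟨hST.mono_left Set.sdiff_subset,
        hS.reachSet_disjoint.mono_left Set.inter_subset_right⟩
  have hsub : conflictSet X Ψ S ⊆ S := fun _ h => h.1
  have h₁ := Set.ncard_sdiff_add_ncard_of_subset hsub
  have h₂ := Set.ncard_union_le (S \ conflictSet X Ψ S)
    (copies X ∩ reachSet I.auxGraph {a} S)
  omega

/-- If `R(A, S) ∪ S` is regular, then relabeling `R(A, S)` according to its copies and deleting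
the conflicting part of `S` repairs the labeling `Ψ`. -/
theorem exists_labeling_of_isGood {I : NULCInstance V L} {X : Set V} {Ψ : {u : V // u ∉ X} → L}
    (hfeas : I.IsFeasible X Ψ) (hcons : I.IsConsistent X Ψ) {A S : Set (V × L)}
    (hS : IsSeparator I.auxGraph A I.forbidden S) (hgood : I.IsGood A S) :
    ∃ Ψ' : {u : V // u ∉ (X \ proj (reachSet I.auxGraph A S)) ∪ proj (conflictSet X Ψ S)} → L,
      I.IsFeasible _ Ψ' ∧ I.IsConsistent _ Ψ' := by
  set R := reachSet I.auxGraph A S with hR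
  set X' := (X \ proj R) ∪ proj (conflictSet X Ψ S) with hX'
  have hnot : ∀ u : {u : V // u ∉ X'}, u.1 ∉ proj R → u.1 ∉ X :=
    fun u hu hX => u.2 (Or.inl ⟨hX, hu⟩)
  have hex : ∀ u : {u : V // u ∉ X'}, ∃ i : L,
      (u.1, i) ∈ R ∨ (u.1 ∉ proj R ∧ (u.1, i) ∈ graphOf X Ψ) := by
    intro u
    by_cases hu : u.1 ∈ proj R
    · obtain ⟨i, hi⟩ := mem_proj.1 hu
      exact ⟨i, Or.inl hi⟩
    · exact ⟨Ψ ⟨u.1, hnot u hu⟩, Or.inr ⟨hu, hnot u hu, rfl⟩⟩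
  choose Ψ' hΨ' using hex
  -- The copy of `w` reached from `R` lies in `R ∪ S`. If `w` is labeled from `R`, regularity
  -- identifies the two copies; otherwise the reached copy is in `S`, and a disagreement with `Ψ`
  -- would put `w` in `X'`.
  have hstep : ∀ (u w : {u : V // u ∉ X'}) (h : I.G.Adj u.1 w.1), (u.1, Ψ' u) ∈ R →
      I.perm h (Ψ' u) = Ψ' w := by
    intro u w h hu
    have hadj : I.auxGraph.Adj (u.1, Ψ' u) (w.1, I.perm h (Ψ' u)) := ⟨h, rfl⟩
    have hmem := mem_reachSet_union_of_adj hu hadj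
    rcases hΨ' w with hw | ⟨hwR, hwX, hw⟩
    · exact IsRegular.eq hgood hmem (Or.inl hw)
    · rcases hmem with hmem | hmem
      · exact absurd (mem_proj.2 ⟨_, hmem⟩) hwR
      · by_contra hne
        refine w.2 (Or.inr (mem_proj.2 ⟨_, hmem, hwX, ?_⟩))
        rintro ⟨_, hw'⟩
        exact hne (hw'.symm.trans hw)
  refine ⟨Ψ', fun u w h => ?_, fun u => ?_⟩
  · rcases hΨ' u with hu | ⟨-, hu⟩
    · exact hstep u w h hu
    rcases hΨ' w with hw | ⟨-, hw⟩
    · rw [← hstep w u h.symm hw, I.perm_symm h]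
      simp
    · obtain ⟨huX, hu⟩ := hu
      obtain ⟨hwX, hw⟩ := hw
      dsimp only at hu hw
      rw [← hu, ← hw]
      exact hfeas ⟨u.1, huX⟩ ⟨w.1, hwX⟩ h
  · rcases hΨ' u with hu | ⟨-, hu⟩
    · exact not_not.1 (Set.disjoint_left.1 hS.reachSet_disjoint hu)
    · exact not_not.1 (Set.disjoint_left.1 hcons.graphOf_disjoint_forbidden hu)

/-- Regularity makes the projection to `V` injective on `Z`. -/
theorem IsRegular.ncard_copies_inter_le [Finite V] {X : Set V} {Z : Set (V × L)}
    (hZ : IsRegular Z) : (copies X ∩ Z).ncard ≤ (X ∩ proj Z).ncard := by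
  refine Set.ncard_le_ncard_of_injOn Prod.fst ?_ ?_ (Set.toFinite _)
  · rintro ⟨u, i⟩ ⟨hu, hi⟩
    exact ⟨hu, mem_proj.2 ⟨i, hi⟩⟩
  · rintro ⟨u, i⟩ ⟨-, hi⟩ ⟨w, j⟩ ⟨-, hj⟩ h
    obtain rfl : u = w := h
    rw [hZ.eq hi hj]

theorem IsRegular.mono {Y Z : Set (V × L)} (hZ : IsRegular Z) (h : Y ⊆ Z) : IsRegular Y :=
  fun u => (Set.encard_le_encard (Set.inter_subset_inter_left _ h)).trans (hZ u)

end NULCInstance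

open NULCInstance in
theorem mainTheorem2 {V L : Type*} [Finite V] [Finite L] (I : NULCInstance V L)
    (X : Set V) (hXk : X.ncard ≤ I.k)
    (Ψ : {u : V // u ∉ X} → L) (hfeas : I.IsFeasible X Ψ) (hcons : I.IsConsistent X Ψ)
    (v : V) (hv : v ∉ X) (α : L) (hτ : I.τ v = {α}) :
    IsSeparator I.auxGraph {(v, α)} I.forbidden (NULCInstance.copies X) ∧
    ∀ S : Set (V × L),
      (IsMinimumSet (IsSeparator I.auxGraph {(v, α)} I.forbidden) S ∨
        IsMinimumSet (IsStrictSeparator I.auxGraph {(v, α)} I.forbidden) S) →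
      I.IsGood {(v, α)} S →
      ∃ X' : Set V, I.IsSolution X' ∧
        Disjoint X' (NULCInstance.proj (reachSet I.auxGraph {(v, α)} S)) ∧
        X'.ncard ≤ X.ncard ∧
        (IsMinimumSet I.IsSolution X → IsMinimumSet I.IsSolution X') := by
  have ha : (v, α) ∈ graphOf X Ψ := by
    have h : Ψ ⟨v, hv⟩ ∈ I.τ v := hcons ⟨v, hv⟩
    rw [hτ] at h
    exact ⟨hv, h⟩
  refine ⟨isSeparator_copies hfeas hcons ha, fun S hmin hgood => ?_⟩
  have hS : IsSeparator I.auxGraph {(v, α)} I.forbidden S :=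
    hmin.elim (fun h => h.1) (fun h => h.1.1)
  set R := reachSet I.auxGraph {(v, α)} S with hR
  have hcard : ((X \ proj R) ∪ proj (conflictSet X Ψ S)).ncard ≤ X.ncard := by
    have h₁ := Set.ncard_union_le (X \ proj R) (proj (conflictSet X Ψ S))
    have h₂ : (proj (conflictSet X Ψ S)).ncard ≤ (conflictSet X Ψ S).ncard := by
      rw [proj_eq_image]
      exact Set.ncard_image_le (Set.toFinite _)
    have h₃ : _ ≤ (copies X ∩ R).ncard := ncard_conflictSet_le hfeas ha hmin
    have h₄ : (copies X ∩ R).ncard ≤ (X ∩ proj R).ncard :=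
      (IsRegular.mono hgood Set.subset_union_left).ncard_copies_inter_le
    have h₅ := Set.ncard_inter_add_ncard_sdiff_eq_ncard X (proj R)
    omega
  have hsol : I.IsSolution ((X \ proj R) ∪ proj (conflictSet X Ψ S)) :=
    ⟨hcard.trans hXk, exists_labeling_of_isGood hfeas hcons hS hgood⟩
  refine ⟨_, hsol, ?_, hcard, fun hX => ⟨hsol, fun Y hY => hcard.trans (hX.2 Y hY)⟩⟩
  refine Set.disjoint_union_left.2 ⟨Set.disjoint_sdiff_left, Set.disjoint_left.2 ?_⟩
  intro u huS huR
  obtain ⟨i, hi⟩ := mem_proj.1 huS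
  obtain ⟨j, hj⟩ := mem_proj.1 huR
  -- By regularity of `R ∪ S`, the copies of `u` in `S` and in `R` coincide, although `R` avoids
  -- `S`.
  obtain rfl : i = j := IsRegular.eq hgood (Or.inr hi.1) (Or.inl hj)
  exact Set.disjoint_left.1 reachSet_disjoint_separator hj hi.1
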